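/- Let $n\ge 0$ be an integer and let $\mathbb{C}[P]$ be the polynomial ring in the $\binom{n+1}{2}$ entries $p_{ij}=p_{ji}$ of a generic symmetric $n\times n$ matrix $P$. Let $I_n\subset\mathbb{C}[P]$ be the ideal generated by the entries of $P^2-P$. For $0\le d\le n$, set $I_{n,d}=I_n+\langle \operatorname{trace}(P)-d\rangle$, and let $\mathrm{pGr}(d,n)=V(I_{n,d})$ be the projection Grassmannian, that is, the set of complex symmetric $n\times n$ matrices $P$ with $P^2=P$ and $\operatorname{trace}(P)=d$. Then the ideal $I_n$ is radical. For each $d=0,\ldots,n$ the ideal $I_{n,d}$ is prime, and it is the ideal of all polynomials in $\mathbb{C}[P]$ that vanish on $\mathrm{pGr}(d,n)$. The ideal $I_n$ has exactly $n+1$ minimal primes, namely the ideals $I_{n,d}$ for $d=0,1,\ldots,n$, one for each Grassmannian $\mathrm{pGr}(d,n)$, and $$I_n \;=\; \bigcap_{d=0}^{n} I_{n,d}.$$ -/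

import Mathlib

/-- The polynomial ring `ℂ[P]` whose unknowns are the `n(n+1)/2` entries of a symmetric
`n × n` matrix, indexed by unordered pairs of indices. -/
abbrev SymPoly (n : ℕ) : Type := MvPolynomial (Sym2 (Fin n)) ℂ

/-- The generic symmetric `n × n` matrix `P = (p_{ij})`. -/
noncomputable def genericSymm (n : ℕ) : Matrix (Fin n) (Fin n) (SymPoly n) :=
  Matrix.of fun i j => MvPolynomial.X s(i, j)

/-- The ideal `I_n` generated by the entries of `P² - P`. -/
noncomputable def projIdeal (n : ℕ) : Ideal (SymPoly n) :=
  Ideal.span (Set.range fun ij : Fin n × Fin n =>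
    ((genericSymm n) ^ 2 - genericSymm n) ij.1 ij.2)

/-- The ideal `I_{n,d} = I_n + ⟨trace(P) - d⟩`. -/
noncomputable def projGrassIdeal (n d : ℕ) : Ideal (SymPoly n) :=
  projIdeal n ⊔ Ideal.span {(genericSymm n).trace - (d : SymPoly n)}

/-- The projection Grassmannian `pGr(d,n) = V(I_n + ⟨trace(P) - d⟩)`, as a set of points of the
affine space of complex symmetric `n × n` matrices. -/
noncomputable def projGrass (d n : ℕ) : Set (Sym2 (Fin n) → ℂ) :=
  MvPolynomial.zeroLocus ℂ (projGrassIdeal n d)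

/-!
A symmetric projection of rank `d` is determined by its image: if the columns of an `n × d` matrix
`Y` are a basis of the image, then `Yᵀ Y` is invertible and the projection is `Y (Yᵀ Y)⁻¹ Yᵀ`. The
matrices `Y` with `det (Yᵀ Y) ≠ 0` form an open subscheme of affine space, so the polynomials
vanishing on all these projections form a prime ideal `J_d`, which contains `I_{n,d}`.

Conversely, let `M_S` have the rows of `P` at the indices in `S` and those of `1 - P` elsewhere.
By multilinearity `∑_S det M_S = det (P + (1 - P)) = 1`. Over any ring in which `P² = P` and
`det M_S` is invertible, `P` factors as `Y Z` with `Z Y = 1` through `|S|` dimensions, hence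
`P = Y (Yᵀ Y)⁻¹ Yᵀ` because `P` is symmetric. So every element of `J_{|S|}` is annihilated modulo
`I_n` by a power of `det M_S`. Since the `det M_S` generate the unit ideal, `I_n = ⋂ J_d`, and since
the `I_{n,d}` are pairwise coprime, `I_{n,d} = J_d`.
-/

section CommutativeAlgebra

theorem exists_pow_mul_mem_of_algebraMap_eq_zero {R : Type*} [CommRing R] {I : Ideal R} {f a : R}
    (h : algebraMap R (Localization.Away (Ideal.Quotient.mk I f)) a = 0) :
    ∃ k : ℕ, f ^ k * a ∈ I := by
  rw [IsScalarTower.algebraMap_apply R (R ⧸ I), IsLocalization.map_eq_zero_iff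
    (Submonoid.powers (Ideal.Quotient.mk I f))] at h
  obtain ⟨⟨_, k, rfl⟩, hk⟩ := h
  refine ⟨k, Ideal.Quotient.eq_zero_iff_mem.1 ?_⟩
  rwa [map_mul, map_pow]

theorem minimalPrimes_iInf_eq_image {R ι : Type*} [CommSemiring R] {s : Finset ι} {p : ι → Ideal R}
    (hp : ∀ i ∈ s, (p i).IsPrime) (h_antichain : ∀ i ∈ s, ∀ j ∈ s, p i ≤ p j → i = j) :
    (⨅ i ∈ s, p i).minimalPrimes = p '' s := by
  have exists_le (q : Ideal R) (hq : q.IsPrime) (h : ⨅ i ∈ s, p i ≤ q) : ∃ i ∈ s, p i ≤ q := by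
    rwa [← Finset.inf_eq_iInf, hq.inf_le'] at h
  ext q
  constructor
  · rintro ⟨⟨hq, hsq⟩, hmin⟩
    obtain ⟨i, hi, hiq⟩ := exists_le q hq hsq
    exact ⟨i, hi, hiq.antisymm (hmin ⟨hp i hi, iInf₂_le i hi⟩ hiq)⟩
  · rintro ⟨i, hi, rfl⟩
    refine ⟨⟨hp i hi, iInf₂_le i hi⟩, fun q ⟨hq, hsq⟩ hqi => ?_⟩
    obtain ⟨j, hj, hjq⟩ := exists_le q hq hsq
    rwa [h_antichain j hj i hi (hjq.trans hqi)] at hjq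

end CommutativeAlgebra

section RowPiecewise

open Matrix

variable {m n p R : Type*} [DecidableEq m]

/-- The matrix whose rows with index in `S` are those of `A` and whose other rows are those
of `B`. -/
def rowPiecewise (S : Finset m) (A B : Matrix m n R) : Matrix m n R :=
  of (S.piecewise A.row B.row)

theorem rowPiecewise_apply (S : Finset m) (A B : Matrix m n R) (i : m) (j : n) :
    rowPiecewise S A B i j = if i ∈ S then A i j else B i j := by
  by_cases hi : i ∈ S <;> simp [rowPiecewise, hi]

theorem rowPiecewise_map {R' : Type*} (S : Finset m) (A B : Matrix m n R) (f : R → R') :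
    (rowPiecewise S A B).map f = rowPiecewise S (A.map f) (B.map f) := by
  ext i j
  simp only [rowPiecewise_apply, map_apply, apply_ite f]

theorem rowPiecewise_mul [Fintype n] [NonUnitalNonAssocSemiring R] (S : Finset m)
    (A B : Matrix m n R) (C : Matrix n p R) :
    rowPiecewise S A B * C = rowPiecewise S (A * C) (B * C) := by
  ext i j
  by_cases hi : i ∈ S <;> simp [rowPiecewise_apply, mul_apply, hi]

theorem det_add_eq_sum_det_rowPiecewise [Fintype m] [CommRing R] (A B : Matrix m m R) :
    (A + B).det = ∑ S : Finset m, (rowPiecewise S A B).det :=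
  (detRowAlternating (n := m) (R := R)).map_add_univ A.row B.row

theorem sum_det_rowPiecewise_one_sub [Fintype m] [CommRing R] (P : Matrix m m R) :
    ∑ S : Finset m, (rowPiecewise S P (1 - P)).det = 1 := by
  rw [← det_add_eq_sum_det_rowPiecewise, add_sub_cancel, det_one]

/-- If `M` is the matrix that mixes the rows of `P` and `1 - P`, then `M * P` is `P` with the rows
outside `S` erased, so `P = M⁻¹ * (M * P)` only involves the columns of `M⁻¹` in `S`. -/
theorem exists_rankFactorization_of_isIdempotentElem {k : Type*} [Fintype m] [Fintype k]
    [DecidableEq k] [CommRing R] {P : Matrix m m R} (hP : IsIdempotentElem P) {S : Finset m}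
    (hS : IsUnit (rowPiecewise S P (1 - P)).det) (hk : Fintype.card k = S.card) :
    ∃ (Y : Matrix m k R) (Z : Matrix k m R), Y * Z = P ∧ Z * Y = 1 := by
  obtain e : k ≃ S := Fintype.equivOfCardEq (by simpa using hk)
  let M := rowPiecewise S P (1 - P)
  let N := M⁻¹
  have mul_inv_apply (i : m) (hi : i ∈ S) (j : m) : (P * N) i j = (1 : Matrix m m R) i j := by
    rw [← M.mul_nonsing_inv hS, rowPiecewise_mul, rowPiecewise_apply, if_pos hi]
  refine ⟨N.submatrix id (fun a => e a), P.submatrix (fun a => e a) id, ?_, ?_⟩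
  · have hMP : M * P = rowPiecewise S P 0 := by
      rw [rowPiecewise_mul, hP, sub_mul, one_mul, hP, sub_self]
    ext i j
    calc (N.submatrix id (fun a => e a) * P.submatrix (fun a => e a) id) i j
        = ∑ s : S, N i s * P s j := e.sum_comp fun s : S => N i s * P s j
      _ = ∑ s ∈ S, N i s * P s j := S.sum_coe_sort fun s => N i s * P s j
      _ = (N * (M * P)) i j := by simp [hMP, mul_apply, rowPiecewise_apply]
      _ = P i j := by rw [← mul_assoc, M.nonsing_inv_mul hS, one_mul]
  · ext a b
    calc (P * N) (e a) (e b) = (1 : Matrix m m R) (e a) (e b) := mul_inv_apply _ (e a).2 _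
      _ = (1 : Matrix k k R) a b := by simp [one_apply]

end RowPiecewise

section GramProj

open Matrix

variable {m k R : Type*} [Fintype m] [Fintype k] [DecidableEq k] [CommRing R]

/-- The orthogonal projection `Y (Yᵀ Y)⁻¹ Yᵀ` onto the column space of `Y`, for the bilinear form
`xᵀ y`. The inverse is the junk value `0` when the Gram determinant `det (Yᵀ Y)` is not a unit. -/
noncomputable def gramProj (Y : Matrix m k R) : Matrix m m R :=
  Y * ((Yᵀ * Y)⁻¹ * Yᵀ)

theorem gramProj_isSymm (Y : Matrix m k R) : (gramProj Y).IsSymm := by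
  simp [gramProj, IsSymm, transpose_mul, transpose_nonsing_inv, Matrix.mul_assoc]

theorem gram_inv_mul_transpose_mul {Y : Matrix m k R} (hY : IsUnit (Yᵀ * Y).det) :
    (Yᵀ * Y)⁻¹ * Yᵀ * Y = 1 := by
  rw [Matrix.mul_assoc, nonsing_inv_mul _ hY]

theorem isIdempotentElem_gramProj {Y : Matrix m k R} (hY : IsUnit (Yᵀ * Y).det) :
    IsIdempotentElem (gramProj Y) := by
  rw [IsIdempotentElem, gramProj, Matrix.mul_assoc, ← Matrix.mul_assoc _ Y,
    gram_inv_mul_transpose_mul hY, Matrix.one_mul]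

theorem trace_gramProj {Y : Matrix m k R} (hY : IsUnit (Yᵀ * Y).det) :
    (gramProj Y).trace = Fintype.card k := by
  rw [gramProj, trace_mul_comm, gram_inv_mul_transpose_mul hY, trace_one]

section RankFactorization

variable {P : Matrix m m R} {Y : Matrix m k R} {Z : Matrix k m R}

theorem mul_transpose_mul_gram_eq_one (hP : P.IsSymm) (hYZ : Y * Z = P) (hZY : Z * Y = 1) :
    Z * Zᵀ * (Yᵀ * Y) = 1 := by
  calc Z * Zᵀ * (Yᵀ * Y) = Z * (Y * Z)ᵀ * Y := by simp only [transpose_mul, Matrix.mul_assoc]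
    _ = Z * Y * (Z * Y) := by rw [hYZ, hP, ← hYZ]; simp only [Matrix.mul_assoc]
    _ = 1 := by rw [hZY, Matrix.one_mul]

theorem isUnit_det_gram (hP : P.IsSymm) (hYZ : Y * Z = P) (hZY : Z * Y = 1) :
    IsUnit (Yᵀ * Y).det :=
  isUnit_det_of_left_inverse (mul_transpose_mul_gram_eq_one hP hYZ hZY)

theorem gramProj_eq (hP : P.IsSymm) (hYZ : Y * Z = P) (hZY : Z * Y = 1) : gramProj Y = P := by
  rw [gramProj, inv_eq_left_inv (mul_transpose_mul_gram_eq_one hP hYZ hZY)]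
  calc Y * (Z * Zᵀ * Yᵀ) = Y * Z * (Y * Z)ᵀ := by simp only [transpose_mul, Matrix.mul_assoc]
    _ = Y * (Z * Y) * Z := by rw [hYZ, hP, ← hYZ]; simp only [Matrix.mul_assoc]
    _ = P := by rw [hZY, Matrix.mul_one, hYZ]

end RankFactorization

theorem gramProj_map {R' : Type*} [CommRing R'] {Y : Matrix m k R} (hY : IsUnit (Yᵀ * Y).det)
    (f : R →+* R') : (gramProj Y).map f = gramProj (Y.map f) := by
  refine (gramProj_eq (Z := ((Yᵀ * Y)⁻¹ * Yᵀ).map f) ((gramProj_isSymm Y).map f) ?_ ?_).symm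
  · rw [← Matrix.map_mul, gramProj]
  · rw [← Matrix.map_mul, gram_inv_mul_transpose_mul hY, Matrix.map_one f f.map_zero f.map_one]

end GramProj

section FrameRing

open Matrix MvPolynomial

variable (R m k : Type*) [Fintype m] [Fintype k] [DecidableEq k] [CommRing R]

/-- The Gram determinant `det (Yᵀ Y)` of the generic `m × k` matrix `Y`. -/
noncomputable def gramDet : MvPolynomial (m × k) R :=
  ((mvPolynomialX m k R)ᵀ * mvPolynomialX m k R).det

/-- The coordinate ring of the open subscheme `det (Yᵀ Y) ≠ 0` of the affine space of `m × k`
matrices `Y`; the columns of such a `Y` are a basis of a nondegenerate subspace. -/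
abbrev FrameRing : Type _ := Localization.Away (gramDet R m k)

/-- The tautological matrix over `FrameRing R m k`. -/
noncomputable def genericFrame : Matrix m k (FrameRing R m k) :=
  (mvPolynomialX m k R).map (algebraMap _ _)

theorem isUnit_det_gram_genericFrame :
    IsUnit ((genericFrame R m k)ᵀ * genericFrame R m k).det := by
  rw [genericFrame, ← transpose_map, ← Matrix.map_mul, ← RingHom.mapMatrix_apply, ← RingHom.map_det]
  exact IsLocalization.Away.algebraMap_isUnit (gramDet R m k)

variable {R m k}

theorem aeval_gramDet {A : Type*} [CommRing A] [Algebra R A] (Y : Matrix m k A) :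
    aeval (fun ij : m × k => Y ij.1 ij.2) (gramDet R m k) = (Yᵀ * Y).det := by
  have hY : (mvPolynomialX m k R).map (aeval fun ij : m × k => Y ij.1 ij.2) = Y := by
    ext i j
    simp
  rw [gramDet, AlgHom.map_det, AlgHom.mapMatrix_apply, Matrix.map_mul, transpose_map, hY]

theorem exists_algHom_map_genericFrame_eq {A : Type*} [CommRing A] [Algebra R A]
    {Y : Matrix m k A} (hY : IsUnit (Yᵀ * Y).det) :
    ∃ ψ : FrameRing R m k →ₐ[R] A, (genericFrame R m k).map ψ = Y := by
  rw [← aeval_gramDet (R := R)] at hY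
  refine ⟨IsLocalization.Away.liftAlgHom (gramDet R m k) hY, ?_⟩
  ext i j
  simp [genericFrame]

theorem gramDet_ne_zero [Nontrivial R] (f : k ↪ m) : gramDet R m k ≠ 0 := by
  classical
  intro h
  have hf : ((1 : Matrix m m R).submatrix id f)ᵀ * (1 : Matrix m m R).submatrix id f = 1 := by
    rw [transpose_submatrix, transpose_one, ← submatrix_mul _ _ _ _ _ Function.bijective_id,
      Matrix.one_mul, submatrix_one f f.injective]
  have h_one := aeval_gramDet (R := R) ((1 : Matrix m m R).submatrix id f)
  rw [h, map_zero, hf, det_one] at h_one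
  exact zero_ne_one h_one

end FrameRing

section EvalSymm

open MvPolynomial

variable {n : ℕ} {A : Type*} [CommRing A] [Algebra ℂ A]

/-- Evaluation of polynomials in the entries of a symmetric matrix at `Q`. -/
noncomputable def evalSymm (Q : Matrix (Fin n) (Fin n) A) (hQ : Q.IsSymm) : SymPoly n →ₐ[ℂ] A :=
  aeval (Sym2.lift ⟨Q, fun i j => hQ.apply j i⟩)

theorem genericSymm_map_evalSymm (Q : Matrix (Fin n) (Fin n) A) (hQ : Q.IsSymm) :
    (genericSymm n).map (evalSymm Q hQ) = Q := by
  ext i j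
  simp [evalSymm, genericSymm]

theorem algHom_eq_of_genericSymm_map_eq {φ ψ : SymPoly n →ₐ[ℂ] A}
    (h : (genericSymm n).map φ = (genericSymm n).map ψ) : φ = ψ := by
  refine MvPolynomial.algHom_ext fun z => ?_
  induction z with
  | _ i j => exact congrFun (congrFun h i) j

theorem genericSymm_isSymm (n : ℕ) : (genericSymm n).IsSymm := by
  ext i j
  simp [genericSymm, Sym2.eq_swap]

theorem projIdeal_le_ker_iff (φ : SymPoly n →ₐ[ℂ] A) :
    projIdeal n ≤ RingHom.ker φ ↔ IsIdempotentElem ((genericSymm n).map φ) := by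
  have hφ : (genericSymm n ^ 2 - genericSymm n).map φ =
      (genericSymm n).map φ * (genericSymm n).map φ - (genericSymm n).map φ := by
    rw [pow_two, Matrix.map_sub, Matrix.map_mul]
    exact map_sub φ
  rw [IsIdempotentElem, ← sub_eq_zero, ← hφ, projIdeal, Ideal.span_le, Set.range_subset_iff,
    Prod.forall, ← Matrix.ext_iff]
  rfl

theorem trace_sub_natCast_mem_ker_iff (φ : SymPoly n →ₐ[ℂ] A) (d : ℕ) :
    (genericSymm n).trace - (d : SymPoly n) ∈ RingHom.ker φ ↔
      ((genericSymm n).map φ).trace = d := by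
  rw [RingHom.mem_ker, map_sub, map_natCast, sub_eq_zero, AddMonoidHom.map_trace]

end EvalSymm

section FrameIdeal

variable {n d : ℕ}

/-- The ideal of the closure of the image of `Y ↦ Y (Yᵀ Y)⁻¹ Yᵀ`, for `n × d` matrices `Y` with
`det (Yᵀ Y) ≠ 0`. There are none for `n < d`; the frame ring is then zero and the ideal is `⊤`. -/
noncomputable def frameIdeal (n d : ℕ) : Ideal (SymPoly n) :=
  RingHom.ker (evalSymm (gramProj (genericFrame ℂ (Fin n) (Fin d))) (gramProj_isSymm _))

theorem frameIdeal_isPrime (hd : d ≤ n) : (frameIdeal n d).IsPrime := by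
  have : IsDomain (FrameRing ℂ (Fin n) (Fin d)) :=
    Localization.Away.isDomain (gramDet_ne_zero (Fin.castLEEmb hd))
  exact RingHom.ker_isPrime _

theorem projGrassIdeal_le_frameIdeal (n d : ℕ) : projGrassIdeal n d ≤ frameIdeal n d := by
  have hY := isUnit_det_gram_genericFrame ℂ (Fin n) (Fin d)
  refine sup_le ((projIdeal_le_ker_iff _).2 ?_)
    ((Ideal.span_singleton_le_iff_mem _).2 ((trace_sub_natCast_mem_ker_iff _ d).2 ?_))
  · rw [genericSymm_map_evalSymm]
    exact isIdempotentElem_gramProj hY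
  · rw [genericSymm_map_evalSymm, trace_gramProj hY, Fintype.card_fin]

theorem frameIdeal_le_ker {A : Type*} [CommRing A] [Algebra ℂ A] {φ : SymPoly n →ₐ[ℂ] A}
    {Y : Matrix (Fin n) (Fin d) A} {Z : Matrix (Fin d) (Fin n) A}
    (hYZ : Y * Z = (genericSymm n).map φ) (hZY : Z * Y = 1) :
    frameIdeal n d ≤ RingHom.ker φ := by
  have hP : ((genericSymm n).map φ).IsSymm := (genericSymm_isSymm n).map φ
  obtain ⟨ψ, hψ⟩ := exists_algHom_map_genericFrame_eq (R := ℂ) (isUnit_det_gram hP hYZ hZY)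
  have hφ : ψ.comp (evalSymm (gramProj (genericFrame ℂ (Fin n) (Fin d))) (gramProj_isSymm _)) =
      φ := by
    apply algHom_eq_of_genericSymm_map_eq
    rw [AlgHom.coe_comp, ← Matrix.map_map, genericSymm_map_evalSymm, ← gramProj_eq hP hYZ hZY, ← hψ]
    exact gramProj_map (isUnit_det_gram_genericFrame ℂ (Fin n) (Fin d)) ψ.toRingHom
  intro a ha
  rw [RingHom.mem_ker, ← hφ, AlgHom.comp_apply, (RingHom.mem_ker).1 ha, map_zero]

end FrameIdeal

section Charts

variable {n : ℕ}

/-- The determinant of the generic symmetric matrix `P` with its rows outside `S` replaced by those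
of `1 - P`. The nonvanishing loci of these polynomials are the charts of the scheme `P² = P`. -/
noncomputable def chartDet (S : Finset (Fin n)) : SymPoly n :=
  (rowPiecewise S (genericSymm n) (1 - genericSymm n)).det

theorem map_chartDet {A : Type*} [CommRing A] [Algebra ℂ A] (φ : SymPoly n →ₐ[ℂ] A)
    (S : Finset (Fin n)) :
    φ (chartDet S) =
      (rowPiecewise S ((genericSymm n).map φ) (1 - (genericSymm n).map φ)).det := by
  rw [chartDet, AlgHom.map_det, AlgHom.mapMatrix_apply, rowPiecewise_map,
    Matrix.map_sub φ (map_sub φ), Matrix.map_one φ φ.map_zero φ.map_one]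

theorem mem_of_forall_exists_chartDet_pow_mul_mem {J : Ideal (SymPoly n)} {a : SymPoly n}
    (h : ∀ S, ∃ k : ℕ, chartDet S ^ k * a ∈ J) : a ∈ J := by
  refine Submodule.mem_of_span_eq_top_of_smul_pow_mem J (Set.range chartDet) ?_ a
    (Set.forall_subtype_range_iff.2 h)
  rw [Ideal.eq_top_iff_one, ← sum_det_rowPiecewise_one_sub (genericSymm n)]
  exact Ideal.sum_mem _ fun S _ => Ideal.subset_span ⟨S, rfl⟩

theorem exists_chartDet_pow_mul_mem_projIdeal {S : Finset (Fin n)} {a : SymPoly n}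
    (ha : a ∈ frameIdeal n S.card) : ∃ k : ℕ, chartDet S ^ k * a ∈ projIdeal n := by
  let L := Localization.Away (Ideal.Quotient.mk (projIdeal n) (chartDet S))
  let φ : SymPoly n →ₐ[ℂ] L := IsScalarTower.toAlgHom ℂ (SymPoly n) L
  have hφ : projIdeal n ≤ RingHom.ker φ := fun x hx => by
    rw [RingHom.mem_ker, IsScalarTower.toAlgHom_apply,
      IsScalarTower.algebraMap_apply (SymPoly n) (SymPoly n ⧸ projIdeal n),
      Ideal.Quotient.algebraMap_eq, Ideal.Quotient.eq_zero_iff_mem.2 hx, map_zero]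
  have hS : IsUnit (φ (chartDet S)) :=
    IsLocalization.Away.algebraMap_isUnit (Ideal.Quotient.mk (projIdeal n) (chartDet S))
  rw [map_chartDet] at hS
  obtain ⟨Y, Z, hYZ, hZY⟩ := exists_rankFactorization_of_isIdempotentElem
    ((projIdeal_le_ker_iff φ).1 hφ) hS (Fintype.card_fin S.card)
  exact exists_pow_mul_mem_of_algebraMap_eq_zero (frameIdeal_le_ker hYZ hZY ha)

end Charts

section Components

open MvPolynomial

variable {n d e : ℕ}

theorem isCoprime_projGrassIdeal (hde : d ≠ e) :
    IsCoprime (projGrassIdeal n d) (projGrassIdeal n e) := by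
  let c : ℂ := (e : ℂ) - d
  have trace_sub_mem (d : ℕ) : (genericSymm n).trace - (d : SymPoly n) ∈ projGrassIdeal n d :=
    Ideal.mem_sup_right (Ideal.mem_span_singleton_self _)
  have hc : C c =
      (genericSymm n).trace - (d : SymPoly n) - ((genericSymm n).trace - (e : SymPoly n)) := by
    simp [c]
  have hc_mem : C c ∈ projGrassIdeal n d ⊔ projGrassIdeal n e :=
    hc ▸ Ideal.sub_mem _ (Ideal.mem_sup_left (trace_sub_mem d))
      (Ideal.mem_sup_right (trace_sub_mem e))
  have hc_unit : IsUnit (C c : SymPoly n) :=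
    (sub_ne_zero.2 (Nat.cast_injective.ne hde.symm)).isUnit.map C
  exact Ideal.isCoprime_iff_sup_eq.2 (Ideal.eq_top_of_isUnit_mem _ hc_mem hc_unit)

theorem projGrassIdeal_eq_frameIdeal (n d : ℕ) : projGrassIdeal n d = frameIdeal n d := by
  refine (projGrassIdeal_le_frameIdeal n d).antisymm fun a ha =>
    mem_of_forall_exists_chartDet_pow_mul_mem fun S => ?_
  rcases eq_or_ne S.card d with rfl | hS
  · obtain ⟨k, hk⟩ := exists_chartDet_pow_mul_mem_projIdeal ha
    exact ⟨k, Ideal.mem_sup_left hk⟩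
  · obtain ⟨u, hu, v, hv, huv⟩ := Ideal.isCoprime_iff_exists.1 (isCoprime_projGrassIdeal hS)
    obtain ⟨k, hk⟩ := exists_chartDet_pow_mul_mem_projIdeal (projGrassIdeal_le_frameIdeal n _ hu)
    have h_split : chartDet S ^ k * a = chartDet S ^ k * u * a + chartDet S ^ k * a * v := by
      linear_combination -(chartDet S ^ k * a) * huv
    refine ⟨k, h_split ▸ ?_⟩
    exact Ideal.add_mem _ (Ideal.mul_mem_right _ _ (Ideal.mem_sup_left hk))
      (Ideal.mul_mem_left _ _ hv)

theorem projGrassIdeal_isPrime (hd : d ∈ Finset.range (n + 1)) : (projGrassIdeal n d).IsPrime :=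
  projGrassIdeal_eq_frameIdeal n d ▸ frameIdeal_isPrime (Finset.mem_range_succ_iff.1 hd)

theorem eq_of_projGrassIdeal_le (he : e ∈ Finset.range (n + 1))
    (h : projGrassIdeal n d ≤ projGrassIdeal n e) : d = e := by
  by_contra hde
  have h_sup := Ideal.isCoprime_iff_sup_eq.1 (isCoprime_projGrassIdeal (n := n) hde)
  rw [sup_eq_right.2 h] at h_sup
  exact (projGrassIdeal_isPrime he).ne_top h_sup

theorem vanishingIdeal_projGrass (hd : d ∈ Finset.range (n + 1)) :
    vanishingIdeal ℂ (projGrass d n) = projGrassIdeal n d := by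
  rw [projGrass, vanishingIdeal_zeroLocus_eq_radical, (projGrassIdeal_isPrime hd).radical]

theorem projIdeal_eq_iInf_projGrassIdeal (n : ℕ) :
    projIdeal n = ⨅ d ∈ Finset.range (n + 1), projGrassIdeal n d := by
  refine le_antisymm (le_iInf₂ fun d _ => le_sup_left) fun a ha =>
    mem_of_forall_exists_chartDet_pow_mul_mem fun S => exists_chartDet_pow_mul_mem_projIdeal ?_
  rw [← projGrassIdeal_eq_frameIdeal]
  simp only [Ideal.mem_iInf] at ha
  exact ha _ (Finset.mem_range_succ_iff.2 (card_finset_fin_le S))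

theorem isRadical_projIdeal (n : ℕ) : (projIdeal n).IsRadical := by
  rw [projIdeal_eq_iInf_projGrassIdeal]
  exact Ideal.isRadical_iInf _ fun _ =>
    Ideal.isRadical_iInf _ fun hd => (projGrassIdeal_isPrime hd).isRadical

theorem minimalPrimes_projIdeal (n : ℕ) :
    (projIdeal n).minimalPrimes = projGrassIdeal n '' Finset.range (n + 1) := by
  rw [projIdeal_eq_iInf_projGrassIdeal]
  exact minimalPrimes_iInf_eq_image (fun _ => projGrassIdeal_isPrime)
    fun _ _ _ he => eq_of_projGrassIdeal_le he

theorem ncard_minimalPrimes_projIdeal (n : ℕ) : (projIdeal n).minimalPrimes.ncard = n + 1 := by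
  have h_inj : Set.InjOn (projGrassIdeal n) (Finset.range (n + 1)) :=
    fun _ _ _ he h => eq_of_projGrassIdeal_le he h.le
  rw [minimalPrimes_projIdeal, h_inj.ncard_image, Set.ncard_coe_finset, Finset.card_range]

end Components

theorem mainTheorem3 (n : ℕ) :
    (projIdeal n).IsRadical ∧
    (∀ d ∈ Finset.range (n + 1), (projGrassIdeal n d).IsPrime ∧
      MvPolynomial.vanishingIdeal ℂ (projGrass d n) = projGrassIdeal n d) ∧
    (projIdeal n).minimalPrimes = {J | ∃ d ∈ Finset.range (n + 1), J = projGrassIdeal n d} ∧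
    (projIdeal n).minimalPrimes.ncard = n + 1 ∧
    projIdeal n = ⨅ d ∈ Finset.range (n + 1), projGrassIdeal n d := by
  refine ⟨isRadical_projIdeal n,
    fun d hd => ⟨projGrassIdeal_isPrime hd, vanishingIdeal_projGrass hd⟩, ?_,
    ncard_minimalPrimes_projIdeal n, projIdeal_eq_iInf_projGrassIdeal n⟩
  ext J
  simp only [minimalPrimes_projIdeal, Set.mem_image, Finset.mem_coe, Set.mem_ofPred_eq, eq_comm]
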